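/- Let $\mathcal{C}$ be an $\infty$-category (that is, a quasicategory) and let $\alpha$ be an equivalence in $\mathcal{C}$, i.e. an edge of $\mathcal{C}$ whose class in the homotopy category of $\mathcal{C}$ is an isomorphism. Let $n\geq 2$ and let $\bar\alpha\colon \Lambda^n_0\to\mathcal{C}$ be an outer horn whose restriction along the edge $\langle 01\rangle\colon\Delta^1\to\Lambda^n_0$ is $\alpha$. Then the fiber $$\mathcal{C}^{\Delta^n}\times_{\mathcal{C}^{\Lambda^n_0}}\{\bar\alpha\},$$ that is, the fiber over the vertex $\bar\alpha$ of the restriction map $\mathcal{C}^{\Delta^n}\to\mathcal{C}^{\Lambda^n_0}$ of simplicial mapping objects, which parametrizes the extensions of $\bar\alpha$ to $\Delta^n$, is a contractible $\infty$-groupoid: it is a Kan complex $X$, and every map $\partial\Delta^m\to X$ with $m\geq 0$ extends to $\Delta^m$. -/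

import Mathlib

open CategoryTheory Simplicial MonoidalCategory

universe u

namespace InftyCat

/-- An edge `α : x ⟶ y` of an `∞`-category (quasicategory) `C` is an *equivalence* if its class in
the homotopy category of `C` is an isomorphism. -/
def IsEquivalence {C : SSet.{u}} {x y : C _⦋0⦌} (α : SSet.Edge x y) : Prop :=
  IsIso (SSet.Truncated.HomotopyCategory.homMk α.toTruncated)

/-- For `n ≥ 2`, the map `⟨01⟩ : Δ[1] ⟶ Λ[n, 0]` given by the edge `0 → 1` of the horn. -/
def hornEdge01 (n : ℕ) (hn : 2 ≤ n) : (Δ[1] : SSet.{u}) ⟶ (Λ[n, 0] : SSet.{u}) :=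
  SSet.yonedaEquiv.symm (SSet.horn.edge n 0 0 1 (Fin.zero_le _)
    (le_trans (by simpa using Finset.card_insert_le (0 : Fin (n + 1)) {1}) hn))

/-- For a map of simplicial sets `i : A ⟶ B` and a diagram `f : A ⟶ C`, the simplicial set
`C ^ B ×_{C ^ A} {f}` of extensions of `f` along `i`: the pullback of the restriction map
`C ^ B ⟶ C ^ A` along the vertex of `C ^ A` corresponding to `f`. -/
noncomputable def extensionFiber {A B C : SSet.{u}} (i : A ⟶ B) (f : A ⟶ C) : SSet.{u} :=
  Limits.pullback ((MonoidalClosed.pre i).app C) (MonoidalClosed.curry' f)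

/-- A *contractible `∞`-groupoid*: a Kan complex `X` such that the projection from `X` to the
point is a trivial Kan fibration, that is, every map `∂Δ[m] ⟶ X`, `m ≥ 0`, extends to `Δ[m]`. -/
structure IsContractibleInftyGroupoid (X : SSet.{u}) : Prop where
  kanComplex : SSet.KanComplex X
  exists_extension : ∀ (m : ℕ) (β : (∂Δ[m] : SSet.{u}) ⟶ X),
    ∃ γ : (Δ[m] : SSet.{u}) ⟶ X, ∂Δ[m].ι ≫ γ = β

end InftyCat

/-! By adjunction, extending a map from `∂Δ[m]` to the fiber over `Δ[m]` means lifting a horn `Λ[n,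
0] ⟶ C ^ Δ[m]` against the inner fibration `C ^ Δ[m] ⟶ C ^ ∂Δ[m]` of quasicategories, where the horn
consists of constant maps (`exists_extension_extensionFiber`). This is a case of Joyal's lifting of
special outer horns, `exists_lift`.

An inverse `β` of `α : x ⟶ y` gives a `3`-simplex with vertices `x, y, x, y`, edges `01` and `23`
equal to `α`, `12` equal to `β`, and `02`, `13` degenerate (`nonempty_zigZag`). Every map of
simplicial sets preserves such a zig-zag. To fill a horn with vertices `x, y, x₂, …`, work in `Δ[n +
2]` with vertices labelled `x, y, x, y, x₂, …`; call those from `4` on the tail. Precomposing the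
face on `{2} ∪ tail` with `β` yields a simplex on `{1} ∪ tail`, which serves as the face missing
from the horn. It is copied degenerately to `{1, 3} ∪ tail`, and an inner horn on `{0, 1, 3} ∪ tail`
then produces the filler on `{0, 3} ∪ tail`.

Every extension used is along an inner anodyne inclusion, recognised by pairing faces that differ by
one vertex (`innerAnodyneExtensions_homOfLE`). In the relative case the diagram in the base is
extended to all of `Δ[n + 2]` before lifting. -/

namespace SSet

open Opposite

/-! ### Gluing, and a criterion for inner anodyne inclusions -/

namespace Subcomplex

/-- Two morphisms defined on subcomplexes which agree on the intersection can be glued. -/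
lemma exists_glue {X E : SSet.{u}} {A B : X.Subcomplex} (f : (A : SSet.{u}) ⟶ E)
    (g : (B : SSet.{u}) ⟶ E)
    (h : ∀ (d : ℕ) (x : X _⦋d⦌) (hA : x ∈ A.obj _) (hB : x ∈ B.obj _),
      f.app (op ⦋d⦌) ⟨x, hA⟩ = g.app (op ⦋d⦌) ⟨x, hB⟩) :
    ∃ k : ((A ⊔ B : X.Subcomplex) : SSet.{u}) ⟶ E,
      homOfLE (le_sup_left : A ≤ A ⊔ B) ≫ k = f ∧ homOfLE (le_sup_right : B ≤ A ⊔ B) ≫ k = g := by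
  have sq : BicartSq (A ⊓ B) A B (A ⊔ B) := { sup_eq := rfl, inf_eq := rfl }
  have w : homOfLE sq.le₁₂ ≫ f = homOfLE sq.le₁₃ ≫ g := by
    ext ⟨⟨d⟩⟩ ⟨x, hx⟩
    exact h d x hx.1 hx.2
  exact ⟨sq.isPushout.desc f g w, sq.isPushout.inl_desc .., sq.isPushout.inr_desc ..⟩

/-- The inclusion is the pushout of `A ⊓ range φ ⟶ range φ`, which the monomorphism `φ` identifies
with the inclusion of the inner horn. -/
lemma innerAnodyneExtensions_homOfLE_sup_range {X : SSet.{u}} (A : X.Subcomplex) {n : ℕ}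
    {i : Fin (n + 1)} (h0 : 0 < i) (hn : i < Fin.last n) (φ : Δ[n] ⟶ X) [Mono φ]
    (h : A.preimage φ = Λ[n, i]) :
    innerAnodyneExtensions (homOfLE (le_sup_left : A ≤ A ⊔ range φ)) := by
  have sq : BicartSq (A ⊓ range φ) A (range φ) (A ⊔ range φ) := { sup_eq := rfl, inf_eq := rfl }
  refine MorphismProperty.of_isPushout sq.isPushout ?_
  have e : Λ[n, i].image φ = A ⊓ range φ := by
    rw [← h]
    ext d x
    constructor
    · rintro ⟨y, hy, rfl⟩
      exact ⟨hy, y, rfl⟩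
    · rintro ⟨hx, y, rfl⟩
      exact ⟨y, hx, rfl⟩
  have : Mono (Λ[n, i].toImage φ) := mono_of_mono_fac (toImage_ι _ φ)
  have : IsIso (Λ[n, i].toImage φ) := isIso_of_mono_of_epi _
  refine (innerAnodyneExtensions.arrow_mk_iso_iff ?_).1 (innerAnodyneExtensions.horn_ι h0 hn)
  exact Arrow.isoMk (asIso (Λ[n, i].toImage φ) ≪≫ Subcomplex.eqToIso e) (asIso (toRange φ))
    (by ext; rfl)

end Subcomplex

namespace stdSimplex

variable {N : ℕ}

/-- A nonempty face is generated by a single simplex, which lies in one of the two pieces. -/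
lemma face_le_sup_iff (S : Finset (Fin (N + 1))) (A B : (Δ[N] : SSet.{u}).Subcomplex) :
    face S ≤ A ⊔ B ↔ face S ≤ A ∨ face S ≤ B := by
  refine ⟨fun h ↦ ?_, fun h ↦ h.elim (fun h ↦ h.trans le_sup_left) (fun h ↦ h.trans le_sup_right)⟩
  obtain rfl | hS := S.eq_empty_or_nonempty
  · simp
  · obtain ⟨m, hm⟩ := Nat.exists_eq_succ_of_ne_zero hS.card_pos.ne'
    rw [face_eq_ofSimplex S m (S.orderIsoOfFin hm)] at h ⊢
    simp only [Subcomplex.ofSimplex_le_iff] at h ⊢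
    exact h

/-- A monotone section of `x` onto its set of vertices recovers the generator of that face from `x`,
so membership depends only on the vertex set. -/
lemma mem_iff_face_le (A : (Δ[N] : SSet.{u}).Subcomplex) {d : ℕ} (x : (Δ[N] : SSet.{u}) _⦋d⦌) :
    x ∈ A.obj _ ↔ face (Finset.univ.image x) ≤ A := by
  refine ⟨fun hx ↦ ?_, fun h ↦ h _ (by simp [mem_face_iff])⟩
  set S : Finset (Fin (N + 1)) := Finset.univ.image x with hS
  obtain ⟨m, hm⟩ := Nat.exists_eq_succ_of_ne_zero
    (Finset.card_pos.2 ⟨x 0, by simp [hS]⟩ : 0 < S.card).ne'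
  rw [face_eq_ofSimplex S m (S.orderIsoOfFin hm), Subcomplex.ofSimplex_le_iff]
  have hmem : ∀ i, ∃ j, x j = S.orderIsoOfFin hm i := fun i ↦ by
    have := (S.orderIsoOfFin hm i).2
    simpa only [hS, Finset.mem_image, Finset.mem_univ, true_and] using this
  choose g hg using hmem
  have hmono : Monotone g := by
    intro i j hij
    obtain rfl | hij := hij.eq_or_lt
    · rfl
    · by_contra hlt
      have := monotone_apply x (le_of_not_ge hlt)
      simp only [hg] at this
      exact absurd ((S.orderIsoOfFin hm).le_iff_le.1 this) (not_le.2 hij)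
  have := A.map (Quiver.Hom.op (SimplexCategory.Hom.mk ⟨g, hmono⟩ : ⦋m⦌ ⟶ ⦋d⦌)) hx
  refine Set.mem_of_eq_of_mem ?_ (Set.mem_preimage.1 this)
  ext i : 1
  exact (hg i).symm

/-- An inclusion `A ≤ B` of subcomplexes of a standard simplex is inner anodyne if there is
a vertex `b` such that the faces of `B` not in `A` come in pairs `S \ {b}`, `S ∪ {b}`,
with `b` neither the first nor the last vertex of `S ∪ {b}`. -/
lemma innerAnodyneExtensions_homOfLE {A B : (Δ[N] : SSet.{u}).Subcomplex} (h : A ≤ B)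
    (b : Fin (N + 1))
    (hb : ∀ S : Finset (Fin (N + 1)), face S ≤ B → ¬ face S ≤ A →
      face (insert b S) ≤ B ∧ ¬ face (S.erase b) ≤ A ∧ (∃ s ∈ S, s < b) ∧ ∃ s ∈ S, b < s) :
    innerAnodyneExtensions (Subcomplex.homOfLE h) := by
  classical
  induction hk : (Finset.univ.filter fun S : Finset (Fin (N + 1)) ↦
    face S ≤ B ∧ ¬ face S ≤ A).card using Nat.strong_induction_on generalizing A with
  | _ k ih =>
  by_cases hAB : B ≤ A
  · obtain rfl := le_antisymm h hAB
    exact .of_isIso (𝟙 _)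
  let F := Finset.univ.filter fun S : Finset (Fin (N + 1)) ↦ (face S ≤ B ∧ ¬ face S ≤ A) ∧ b ∈ S
  have hF : F.Nonempty := by
    have : ∃ (d : SimplexCategoryᵒᵖ) (x : Δ[N].obj d), x ∈ B.obj d ∧ x ∉ A.obj d := by
      by_contra! hBA
      exact hAB fun d x hx ↦ hBA d x hx
    obtain ⟨⟨⟨d⟩⟩, x, hxB, hxA⟩ := this
    have hxB' := (mem_iff_face_le B x).1 hxB
    have hxA' := (mem_iff_face_le A x).not.1 hxA
    exact ⟨insert b _, by
      simpa [F] using ⟨(hb _ hxB' hxA').1, fun h ↦ hxA'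
        (((face_le_face_iff _ _).2 (Finset.subset_insert _ _)).trans h)⟩⟩
  -- A missing face of least size among those containing `b` meets `A` exactly in its horn at `b`,
  -- so it can be attached.
  obtain ⟨S, hS, hmin⟩ := Finset.exists_min_image F Finset.card hF
  obtain ⟨⟨hSB, hSA⟩, hbS⟩ : (face S ≤ B ∧ ¬ face S ≤ A) ∧ b ∈ S := by simpa [F] using hS
  obtain ⟨-, hSb, ⟨s, hs, hsb⟩, ⟨t, ht, htb⟩⟩ := hb S hSB hSA
  have hproper : ∀ T : Finset (Fin (N + 1)), T ⊂ S → T ≠ S.erase b → face T ≤ A := by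
    intro T hT hTb
    by_contra hTA
    have hTB : face T ≤ B := ((face_le_face_iff _ _).2 hT.subset).trans hSB
    have hmem : insert b T ∈ F := by
      simpa [F] using ⟨(hb T hTB hTA).1, fun h ↦ hTA
        (((face_le_face_iff _ _).2 (Finset.subset_insert _ _)).trans h)⟩
    have hsub : insert b T ⊆ S := Finset.insert_subset hbS hT.subset
    have heq : insert b T = S := Finset.eq_of_subset_of_card_le hsub (hmin _ hmem)
    by_cases hbT : b ∈ T
    · rw [Finset.insert_eq_of_mem hbT] at heq
      exact hT.ne heq
    · exact hTb (by rw [← heq, Finset.erase_insert hbT])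
  obtain ⟨m, hm⟩ := Nat.exists_eq_succ_of_ne_zero
    (Finset.card_pos.2 ⟨b, hbS⟩ : 0 < S.card).ne'
  let e := S.orderIsoOfFin hm
  let φ : Δ[m] ⟶ Δ[N] := SSet.stdSimplex.map (SimplexCategory.Hom.mk
    ((OrderHom.Subtype.val _).comp e.toOrderEmbedding.toOrderHom))
  have hφ_apply : ∀ {d : ℕ} (x : (Δ[m] : SSet.{u}) _⦋d⦌) (i : Fin (d + 1)),
    (φ.app (op ⦋d⦌) x : (Δ[N] : SSet.{u}) _⦋d⦌) i = e (x i) := fun _ _ ↦ rfl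
  have : Mono φ := by
    have (d : SimplexCategoryᵒᵖ) : Mono (φ.app d) := by
      obtain ⟨⟨d⟩⟩ := d
      rw [mono_iff_injective]
      intro x y hxy
      ext i : 1
      apply e.injective
      ext1
      rw [← hφ_apply, ← hφ_apply, hxy]
    exact NatTrans.mono_of_mono_app φ
  have hrange : Subcomplex.range φ = face S := by
    rw [Subcomplex.range_eq_ofSimplex, face_eq_ofSimplex S m e]
    rfl
  let i := e.symm ⟨b, hbS⟩
  have hei : (e i : Fin (N + 1)) = b := by simp [i]
  have hpre : A.preimage φ = Λ[m, i] := by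
    have himage : ∀ {d : ℕ} (x : (Δ[m] : SSet.{u}) _⦋d⦌),
        φ.app (op ⦋d⦌) x ∈ A.obj (op ⦋d⦌) ↔
          face (Finset.univ.image fun j ↦ (e (x j) : Fin (N + 1))) ≤ A := fun x ↦
      mem_iff_face_le A (φ.app _ x)
    ext ⟨⟨d⟩⟩ x
    change φ.app (op ⦋d⦌) x ∈ A.obj (op ⦋d⦌) ↔ _
    refine (himage x).trans ?_
    refine Iff.trans ?_ (mem_horn_iff_notMem_range x i).symm
    constructor
    · intro hx
      by_contra! hcon
      apply hSb
      refine le_trans ((face_le_face_iff _ _).2 ?_) hx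
      intro y hy
      rw [Finset.mem_erase] at hy
      obtain ⟨j, hj⟩ := hcon (e.symm ⟨y, hy.2⟩) (by
        intro h
        apply hy.1
        have := e.symm.injective h
        exact congrArg Subtype.val this)
      simp only [Finset.mem_image, Finset.mem_univ, true_and]
      exact ⟨j, by simp [hj]⟩
    · rintro ⟨j, hji, hj⟩
      have hnot : (e j : Fin (N + 1)) ∉
          Finset.univ.image fun j ↦ (e (x j) : Fin (N + 1)) := by
        simp only [Finset.mem_image, Finset.mem_univ, true_and, not_exists]
        intro k hk
        exact hj ⟨k, e.injective (Subtype.ext hk)⟩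
      refine hproper _ ⟨?_, ?_⟩ ?_
      · intro y hy
        simp only [Finset.mem_image, Finset.mem_univ, true_and] at hy
        obtain ⟨k, rfl⟩ := hy
        exact (e (x k)).2
      · exact fun h ↦ hnot (h (e j).2)
      · intro h
        rw [h] at hnot
        apply hnot
        rw [Finset.mem_erase]
        refine ⟨fun h ↦ hji (e.injective (Subtype.ext (h.trans hei.symm))), (e j).2⟩
  have hlt₀ : 0 < i := by
    refine lt_of_le_of_lt (Fin.zero_le (e.symm ⟨s, hs⟩)) (e.symm.lt_iff_lt.2 ?_)
    exact hsb
  have hltn : i < Fin.last m := by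
    refine lt_of_lt_of_le (e.symm.lt_iff_lt.2 ?_) (Fin.le_last (e.symm ⟨t, ht⟩))
    exact htb
  have hstep := Subcomplex.innerAnodyneExtensions_homOfLE_sup_range A hlt₀ hltn φ hpre
  rw [hrange] at hstep
  have hle : A ⊔ face S ≤ B := sup_le h hSB
  refine MorphismProperty.comp_mem _ _ (Subcomplex.homOfLE hle) hstep (ih _ ?_ hle ?_ rfl)
  · rw [← hk]
    apply Finset.card_lt_card
    refine ⟨fun T hT ↦ ?_, fun h ↦ ?_⟩
    · simp only [Finset.mem_filter, Finset.mem_univ, true_and] at hT ⊢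
      exact ⟨hT.1, fun h ↦ hT.2 (h.trans le_sup_left)⟩
    · have := h (show S ∈ _ by simpa using ⟨hSB, hSA⟩)
      simp at this
  -- The pairing survives the attachment: since `b ∈ S`, `T.erase b ⊆ S` would force `T ⊆ S`.
  · intro T hTB hTA
    rw [face_le_sup_iff, not_or, face_le_face_iff] at hTA
    obtain ⟨h₁, h₂, h₃⟩ := hb T hTB hTA.1
    refine ⟨h₁, ?_, h₃⟩
    rw [face_le_sup_iff, not_or, face_le_face_iff]
    refine ⟨h₂, fun h ↦ hTA.2 ?_⟩
    intro y hy
    by_cases hyb : y = b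
    · rwa [hyb]
    · exact h (Finset.mem_erase.2 ⟨hyb, hy⟩)

end stdSimplex

end SSet

/-! ### Gluing and lifting simplex by simplex -/

namespace SSet

open Opposite Limits

namespace Subcomplex

variable {X Y E S : SSet.{u}} {A B : X.Subcomplex}

/-- The morphism `A ⟶ B` of subcomplexes which is induced by a morphism `θ : X ⟶ Y`
of the ambient simplicial sets. -/
def mapsTo (A : X.Subcomplex) (B : Y.Subcomplex) (θ : X ⟶ Y)
    (h : ∀ (d : ℕ) (x : X _⦋d⦌), x ∈ A.obj _ → θ.app _ x ∈ B.obj (op ⦋d⦌)) :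
    (A : SSet.{u}) ⟶ (B : SSet.{u}) :=
  lift (A.ι ≫ θ) (by rintro ⟨⟨d⟩⟩ _ ⟨x, rfl⟩; exact h d x.1 x.2)

lemma exists_glue_apply (f : (A : SSet.{u}) ⟶ E) (g : (B : SSet.{u}) ⟶ E)
    (h : ∀ (d : ℕ) (x : X _⦋d⦌) (hA : x ∈ A.obj _) (hB : x ∈ B.obj _),
      f.app (op ⦋d⦌) ⟨x, hA⟩ = g.app (op ⦋d⦌) ⟨x, hB⟩) :
    ∃ k : ((A ⊔ B : X.Subcomplex) : SSet.{u}) ⟶ E,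
      (∀ (d : ℕ) (x : X _⦋d⦌) (hx : x ∈ A.obj _),
        k.app (op ⦋d⦌) ⟨x, Or.inl hx⟩ = f.app _ ⟨x, hx⟩) ∧
      ∀ (d : ℕ) (x : X _⦋d⦌) (hx : x ∈ B.obj _),
        k.app (op ⦋d⦌) ⟨x, Or.inr hx⟩ = g.app _ ⟨x, hx⟩ := by
  obtain ⟨k, rfl, rfl⟩ := exists_glue f g h
  exact ⟨k, fun _ _ _ ↦ rfl, fun _ _ _ ↦ rfl⟩

lemma exists_lift_apply {h : A ≤ B} (hi : innerAnodyneExtensions (homOfLE h)) (p : E ⟶ S)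
    [InnerFibration p] (f : (A : SSet.{u}) ⟶ E) (g : X ⟶ S)
    (w : ∀ (d : ℕ) (x : X _⦋d⦌) (hx : x ∈ A.obj _),
      p.app (op ⦋d⦌) (f.app _ ⟨x, hx⟩) = g.app _ x) :
    ∃ k : (B : SSet.{u}) ⟶ E,
      (∀ (d : ℕ) (x : X _⦋d⦌) (hx : x ∈ A.obj _),
        k.app (op ⦋d⦌) ⟨x, h _ hx⟩ = f.app _ ⟨x, hx⟩) ∧
      ∀ (d : ℕ) (x : X _⦋d⦌) (hx : x ∈ B.obj _),
        p.app (op ⦋d⦌) (k.app _ ⟨x, hx⟩) = g.app _ x := by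
  have := hi p (mem_innerFibrations p)
  have sq : CommSq f (homOfLE h) p (B.ι ≫ g) := ⟨by ext ⟨⟨d⟩⟩ ⟨x, hx⟩; exact w d x hx⟩
  refine ⟨sq.lift, fun d x hx ↦ ?_, fun d x hx ↦ ?_⟩
  · exact congr($(sq.fac_left).app (op ⦋d⦌) ⟨x, hx⟩)
  · exact congr($(sq.fac_right).app (op ⦋d⦌) ⟨x, hx⟩)

lemma exists_extension_apply {h : A ≤ B} (hi : innerAnodyneExtensions (homOfLE h))
    [Quasicategory E] (f : (A : SSet.{u}) ⟶ E) :
    ∃ k : (B : SSet.{u}) ⟶ E, ∀ (d : ℕ) (x : X _⦋d⦌) (hx : x ∈ A.obj _),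
        k.app (op ⦋d⦌) ⟨x, h _ hx⟩ = f.app _ ⟨x, hx⟩ := by
  obtain ⟨k, hk, -⟩ := exists_lift_apply hi (terminal.from E) f (terminal.from X)
    (fun d x hx ↦ congr($(Subsingleton.elim (f ≫ terminal.from E)
      (A.ι ≫ terminal.from X)).app (op ⦋d⦌) ⟨x, hx⟩))
  exact ⟨k, hk⟩

end Subcomplex

namespace stdSimplex

variable {N : ℕ}

lemma face_le_iSup_iff (T : Finset (Fin (N + 1))) {ι : Type*} [Nonempty ι]
    (A : ι → (Δ[N] : SSet.{u}).Subcomplex) :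
    face T ≤ ⨆ i, A i ↔ ∃ i, face T ≤ A i := by
  refine ⟨fun h ↦ ?_, fun ⟨i, h⟩ ↦ h.trans (le_iSup A i)⟩
  obtain rfl | hT := T.eq_empty_or_nonempty
  · exact ⟨Classical.arbitrary ι, by simp⟩
  · obtain ⟨m, hm⟩ := Nat.exists_eq_succ_of_ne_zero hT.card_pos.ne'
    rw [face_eq_ofSimplex T m (T.orderIsoOfFin hm)] at h ⊢
    simpa [Subcomplex.ofSimplex_le_iff] using h

/-- The subcomplex of `Δ[N]` consisting of the simplices which miss at least
one vertex of `W`. -/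
def missing (W : Finset (Fin (N + 1))) : (Δ[N] : SSet.{u}).Subcomplex :=
  ⨆ u : W, face {u.1}ᶜ

lemma mem_missing_iff (W : Finset (Fin (N + 1))) {d : ℕ} (x : (Δ[N] : SSet.{u}) _⦋d⦌) :
    x ∈ (missing W).obj _ ↔ ∃ u ∈ W, ∀ i, x i ≠ u := by
  rw [missing, Subfunctor.iSup_obj, Set.mem_iUnion]
  simp only [mem_face_iff, Finset.mem_compl, Finset.mem_singleton, Subtype.exists, exists_prop]

lemma face_le_face_compl_iff (T W : Finset (Fin (N + 1))) :
    face.{u} T ≤ face Wᶜ ↔ ∀ w ∈ W, w ∉ T := by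
  rw [face_le_face_iff, Finset.subset_compl_iff_disjoint_left,
    Finset.disjoint_left]

lemma face_le_missing_iff (T W : Finset (Fin (N + 1))) (hW : W.Nonempty) :
    face.{u} T ≤ missing W ↔ ∃ w ∈ W, w ∉ T := by
  have : Nonempty W := hW.coe_sort
  rw [missing, face_le_iSup_iff]
  simp only [face_le_face_compl_iff, Finset.mem_singleton, forall_eq, Subtype.exists, exists_prop]

/-- The morphism `Δ[m] ⟶ Δ[n]` induced by a monotone map. -/
def mapOrderHom {m n : ℕ} (f : Fin (m + 1) →o Fin (n + 1)) : (Δ[m] : SSet.{u}) ⟶ Δ[n] :=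
  SSet.stdSimplex.map (SimplexCategory.Hom.mk f)

lemma mapOrderHom_app_apply {m n : ℕ} (f : Fin (m + 1) →o Fin (n + 1)) {d : ℕ}
    (x : (Δ[m] : SSet.{u}) _⦋d⦌) (i : Fin (d + 1)) :
    DFunLike.coe (F := (Δ[n] : SSet.{u}) _⦋d⦌) ((mapOrderHom f).app (op ⦋d⦌) x) i = f (x i) :=
  rfl

end stdSimplex

end SSet

/-! ### Combinatorics of `Δ[c + 4]`: the four inner anodyne inclusions -/

namespace SSet

open Opposite Limits

namespace stdSimplex

namespace specialOuterHorn

variable (c : ℕ)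

/-- The vertex `k ≤ 3` of `Δ[c + 4]`. -/
abbrev v (k : ℕ) (hk : k < 4 := by lia) : Fin (c + 5) := ⟨k, by lia⟩

/-- The vertices `≥ 4` of `Δ[c + 4]`. -/
def tail : Finset (Fin (c + 5)) := Finset.univ.filter fun i ↦ 4 ≤ i.1

lemma mem_tail (i : Fin (c + 5)) : i ∈ tail c ↔ 4 ≤ i.1 := by simp [tail]

lemma tail_nonempty : (tail c).Nonempty := ⟨Fin.last _, by simp [mem_tail]⟩

/-- The map `⦋c + 4⦌ ⟶ ⦋c + 2⦌` which sends `0, 1, 2, 3, 4, …` to `0, 0, 0, 1, 2, …`. -/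
def r₁ : Fin (c + 5) →o Fin (c + 3) where
  toFun i := ⟨i.1 - 2, by lia⟩
  monotone' i j h := by simp only [Fin.le_def] at h ⊢; lia

/-- The map `⦋c + 4⦌ ⟶ ⦋c + 2⦌` which sends `0, 1, 2, 3, 4, …` to `1, 1, 1, 1, 2, …`. -/
def r₂ : Fin (c + 5) →o Fin (c + 3) where
  toFun i := ⟨max 1 (i.1 - 2), by lia⟩
  monotone' i j h := by simp only [Fin.le_def] at h ⊢; lia

/-- The map `⦋c + 4⦌ ⟶ ⦋3⦌` which sends `0, 1, 2, 3, 4, …` to `0, 1, 2, 3, 3, …`. -/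
def r₃ : Fin (c + 5) →o Fin 4 where
  toFun i := ⟨min i.1 3, by lia⟩
  monotone' i j h := by simp only [Fin.le_def] at h ⊢; lia

/-- The map `⦋c + 4⦌ ⟶ ⦋c + 4⦌` which sends `0, 1, 2, 3, 4, …` to `1, 1, 1, 1, 4, …`. -/
def ρ : Fin (c + 5) →o Fin (c + 5) where
  toFun i := ⟨if i.1 ≤ 3 then 1 else i.1, by split_ifs <;> lia⟩
  monotone' i j h := by simp only [Fin.le_def] at h ⊢; split_ifs <;> lia

/-- The map `⦋c + 2⦌ ⟶ ⦋c + 4⦌` which sends `0, 1, 2, …` to `0, 3, 4, …`. -/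
def incl : Fin (c + 3) →o Fin (c + 5) where
  toFun i := ⟨if i.1 = 0 then 0 else i.1 + 2, by split_ifs <;> lia⟩
  monotone' i j h := by simp only [Fin.le_def] at h ⊢; split_ifs <;> lia

/-- The map `⦋3⦌ ⟶ ⦋1⦌` which sends `0, 1, 2, 3` to `0, 0, 0, 1`. -/
def q₁ : Fin 4 →o Fin 2 where
  toFun i := ⟨i.1 - 2, by lia⟩
  monotone' i j h := by simp only [Fin.le_def] at h ⊢; lia

/-- The constant map `⦋3⦌ ⟶ ⦋1⦌` with value `1`. -/
def q₂ : Fin 4 →o Fin 2 := OrderHom.const _ 1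

variable {c}

@[simp] lemma r₁_val (i : Fin (c + 5)) : (r₁ c i).1 = i.1 - 2 := rfl
@[simp] lemma r₂_val (i : Fin (c + 5)) : (r₂ c i).1 = max 1 (i.1 - 2) := rfl
@[simp] lemma r₃_val (i : Fin (c + 5)) : (r₃ c i).1 = min i.1 3 := rfl
@[simp] lemma ρ_val (i : Fin (c + 5)) : (ρ c i).1 = if i.1 ≤ 3 then 1 else i.1 := rfl
@[simp] lemma incl_val (i : Fin (c + 3)) : (incl c i).1 = if i.1 = 0 then 0 else i.1 + 2 := rfl
@[simp] lemma q₁_val (i : Fin 4) : (q₁ i).1 = i.1 - 2 := rfl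
@[simp] lemma q₂_val (i : Fin 4) : (q₂ i).1 = 1 := rfl

variable (c)

/-- The simplices of `Δ[c + 4]` which miss a vertex `≥ 4`. -/
def K : (Δ[c + 4] : SSet.{u}).Subcomplex := missing (tail c)

/-- The simplices of `Δ[c + 4]` which miss the vertices `k` and `l`. -/
def D (k l : ℕ) : (Δ[c + 4] : SSet.{u}).Subcomplex :=
  face (Finset.univ.filter fun i ↦ i.1 ≠ k ∧ i.1 ≠ l)

/-- The face of `Δ[c + 4]` with vertices `0, 1, 2, 3`. -/
def T : (Δ[c + 4] : SSet.{u}).Subcomplex := face (tail c)ᶜ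

variable {c}

lemma mem_K_iff {d : ℕ} (x : (Δ[c + 4] : SSet.{u}) _⦋d⦌) :
    x ∈ (K c).obj _ ↔ ∃ u : Fin (c + 5), 4 ≤ u.1 ∧ ∀ i, (x i).1 ≠ u.1 := by
  simp only [K, mem_missing_iff, mem_tail, ne_eq, Fin.ext_iff]

lemma mem_D_iff {d : ℕ} (x : (Δ[c + 4] : SSet.{u}) _⦋d⦌) (k l : ℕ) :
    x ∈ (D c k l).obj _ ↔ ∀ i, (x i).1 ≠ k ∧ (x i).1 ≠ l := by
  simp [D, mem_face_iff]

lemma mem_T_iff {d : ℕ} (x : (Δ[c + 4] : SSet.{u}) _⦋d⦌) :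
    x ∈ (T c).obj _ ↔ ∀ i, (x i).1 < 4 := by
  simp [T, mem_face_iff, mem_tail]

lemma face_le_K_iff (S : Finset (Fin (c + 5))) :
    face.{u} S ≤ K c ↔ ∃ u : Fin (c + 5), 4 ≤ u.1 ∧ u ∉ S := by
  simp only [K, face_le_missing_iff _ _ (tail_nonempty c), mem_tail]

lemma face_le_D_iff (S : Finset (Fin (c + 5))) (k l : ℕ) :
    face.{u} S ≤ D c k l ↔ ∀ i ∈ S, i.1 ≠ k ∧ i.1 ≠ l := by
  simp [D, face_le_face_iff, Finset.subset_iff]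

lemma face_le_T_iff (S : Finset (Fin (c + 5))) :
    face.{u} S ≤ T c ↔ ∀ u : Fin (c + 5), 4 ≤ u.1 → u ∉ S := by
  simp only [T, face_le_face_compl_iff, mem_tail]

lemma T_le_K : T.{u} c ≤ K c := by
  rintro ⟨⟨d⟩⟩ x hx
  rw [mem_K_iff]
  exact ⟨Fin.last _, by simp, fun i ↦ by have := (mem_T_iff x).1 hx i; simp; lia⟩

lemma sup_T_le_K : (K.{u} c ⊓ D c 1 1) ⊔ (K c ⊓ D c 0 2) ⊔ T c ≤ K c :=
  sup_le (sup_le inf_le_left inf_le_left) T_le_K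

/-- The pivot is `3`: a missing face contains `1`, one of `0` and `2`, and a tail vertex, so `3` is
interior and removing it keeps these witnesses. -/
lemma innerAnodyneExtensions_sup_T_le_K :
    innerAnodyneExtensions (Subcomplex.homOfLE (sup_T_le_K.{u} (c := c))) := by
  refine innerAnodyneExtensions_homOfLE _ (v c 3) fun S ↦ ?_
  simp only [face_le_sup_iff, le_inf_iff, face_le_K_iff, face_le_D_iff, face_le_T_iff,
    Fin.lt_def, Finset.mem_insert, Finset.mem_erase, Fin.ext_iff]
  rintro ⟨u, hu, huS⟩ h₂
  push Not at h₂
  obtain ⟨⟨h₂, h₃⟩, t, ht, htS⟩ := h₂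
  obtain ⟨s, hs, hs1⟩ := h₂ ⟨u, hu, huS⟩
  obtain ⟨s', hs', hs2⟩ := h₃ ⟨u, hu, huS⟩
  have hs1 : s.1 = 1 := by lia
  have hs2 : s'.1 = 0 ∨ s'.1 = 2 := by lia
  refine ⟨⟨u, hu, by grind⟩, ?_, ⟨s, hs, by lia⟩, t, htS, by lia⟩
  rintro ((⟨-, h⟩ | ⟨-, h⟩) | h)
  · exact (h s ⟨by lia, hs⟩).1 hs1
  · have := h s' ⟨by lia, hs'⟩
    lia
  · exact h t ht ⟨by lia, htS⟩

lemma K_sup_le_top : K.{u} c ⊔ D c 1 1 ⊔ D c 0 2 ≤ ⊤ := le_top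

/-- The pivot is again `3`: a missing face contains the whole tail, `1`, and one of `0` and `2`. -/
lemma innerAnodyneExtensions_K_sup_le_top :
    innerAnodyneExtensions (Subcomplex.homOfLE (K_sup_le_top.{u} (c := c))) := by
  refine innerAnodyneExtensions_homOfLE _ (v c 3) fun S ↦ ?_
  simp only [face_le_sup_iff, face_le_K_iff, face_le_D_iff, le_top, true_and,
    Fin.lt_def, Finset.mem_erase]
  intro _ h
  push Not at h
  obtain ⟨⟨h₁, s, hs, hs1⟩, s', hs', hs2⟩ := h
  have hs1 : s.1 = 1 := by lia
  have hs2 : s'.1 = 0 ∨ s'.1 = 2 := by lia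
  refine ⟨?_, ⟨s, hs, by lia⟩, Fin.last _, h₁ _ (by simp), by simp⟩
  rintro ((⟨u, hu, h⟩ | h) | h)
  · exact h ⟨by lia, h₁ u hu⟩
  · exact (h s ⟨by lia, hs⟩).1 hs1
  · have := h s' ⟨by lia, hs'⟩
    lia

lemma K_sup_D_le : K.{u} c ⊔ D c 1 3 ≤ K c ⊔ D c 3 3 := sup_le_sup_left (by
    rintro ⟨⟨d⟩⟩ x hx
    exact (mem_D_iff x _ _).2 fun i ↦ by have := (mem_D_iff x _ _).1 hx i; lia) _

/-- The pivot is `2`: a missing face avoids `3` and contains `1` and the tail. The pair `{1} ∪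
tail`, `{1, 2} ∪ tail` is composition with the inverse edge. -/
lemma innerAnodyneExtensions_K_sup_D_le :
    innerAnodyneExtensions (Subcomplex.homOfLE (K_sup_D_le.{u} (c := c))) := by
  refine innerAnodyneExtensions_homOfLE _ (v c 2) fun S ↦ ?_
  simp only [face_le_sup_iff, face_le_K_iff, face_le_D_iff,
    Fin.lt_def, Finset.mem_insert, Finset.mem_erase, Fin.ext_iff]
  intro h h'
  push Not at h'
  obtain ⟨h₁, s, hs, hs1⟩ := h'
  obtain ⟨u, hu, huS⟩ | h := h
  · exact (huS (h₁ u hu)).elim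
  have hs1 : s.1 = 1 := by have := h s hs; lia
  refine ⟨Or.inr ?_, ?_, ⟨s, hs, by lia⟩, Fin.last _, h₁ _ (by simp), by simp⟩
  · rintro i (hi | hi)
    · lia
    · exact h i hi
  · rintro (⟨u, hu, h⟩ | h)
    · exact h ⟨by lia, h₁ u hu⟩
    · exact (h s ⟨by lia, hs⟩).1 hs1

lemma K_sup_face_sup_D_le : K.{u} c ⊔ D c 3 3 ⊔ D c 0 2 ≤ K c ⊔ D c 3 3 ⊔ D c 2 2 := sup_le_sup_left (by
    rintro ⟨⟨d⟩⟩ x hx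
    exact (mem_D_iff x _ _).2 fun i ↦ by have := (mem_D_iff x _ _).1 hx i; lia) _

/-- The only missing faces are `{0, 3} ∪ tail` and `{0, 1, 3} ∪ tail`: this is one inner horn with
pivot `1`. -/
lemma innerAnodyneExtensions_K_sup_face_sup_D_le :
    innerAnodyneExtensions (Subcomplex.homOfLE (K_sup_face_sup_D_le.{u} (c := c))) := by
  refine innerAnodyneExtensions_homOfLE _ (v c 1) fun S ↦ ?_
  simp only [face_le_sup_iff, face_le_K_iff, face_le_D_iff,
    Fin.lt_def, Finset.mem_insert, Finset.mem_erase, Fin.ext_iff]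
  intro h h'
  push Not at h'
  obtain ⟨⟨h₁, s, hs, hs1⟩, s', hs', hs2⟩ := h'
  obtain (⟨u, hu, huS⟩ | h) | h := h
  · exact (huS (h₁ u hu)).elim
  · have := h s hs; lia
  have hs1 : s.1 = 3 := by lia
  have hs2 : s'.1 = 0 := by have := h s' hs'; lia
  refine ⟨Or.inr ?_, ?_, ⟨s', hs', by lia⟩, s, hs, by lia⟩
  · rintro i (hi | hi)
    · lia
    · exact h i hi
  · rintro ((⟨u, hu, h⟩ | h) | h)
    · exact h ⟨by lia, h₁ u hu⟩
    · exact (h s ⟨by lia, hs⟩).1 hs1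
    · exact (h s' ⟨by lia, hs'⟩).1 hs2

end specialOuterHorn

end stdSimplex

end SSet

/-! ### Lifting special outer horns -/

namespace SSet

open Opposite Limits

namespace stdSimplex

namespace specialOuterHorn

variable {c : ℕ}

lemma mem_horn_of_exists {d : ℕ} {y : (Δ[c + 2] : SSet.{u}) _⦋d⦌} (j : Fin (c + 3))
    (hj : j.1 ≠ 0) (h : ∀ i, (y i).1 ≠ j.1) : y ∈ (Λ[c + 2, 0] : Subcomplex _).obj _ :=
  (mem_horn_iff_notMem_range _ _).2 ⟨j, fun h ↦ hj (by simp [h]), by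
    rintro ⟨i, rfl⟩; exact h i rfl⟩

lemma r₁_mem_of_mem_K {d : ℕ} {x : (Δ[c + 4] : SSet.{u}) _⦋d⦌} (hx : x ∈ (K c).obj _) :
    (mapOrderHom (r₁ c)).app _ x ∈ (Λ[c + 2, 0] : Subcomplex _).obj (op ⦋d⦌) := by
  obtain ⟨u, hu, h⟩ := (mem_K_iff x).1 hx
  refine mem_horn_of_exists ⟨u.1 - 2, by lia⟩ (by simp; lia) fun i ↦ ?_
  rw [mapOrderHom_app_apply, r₁_val]
  have := h i
  simp only
  lia

lemma r₁_mem_of_mem_D {d : ℕ} {x : (Δ[c + 4] : SSet.{u}) _⦋d⦌} (hx : x ∈ (D c 1 3).obj _) :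
    (mapOrderHom (r₁ c)).app _ x ∈ (Λ[c + 2, 0] : Subcomplex _).obj (op ⦋d⦌) := by
  refine mem_horn_of_exists ⟨1, by lia⟩ (by simp) fun i ↦ ?_
  rw [mapOrderHom_app_apply, r₁_val]
  have := (mem_D_iff x _ _).1 hx i
  simp only
  lia

lemma r₂_mem_of_mem_K {d : ℕ} {x : (Δ[c + 4] : SSet.{u}) _⦋d⦌} (hx : x ∈ (K c).obj _) :
    (mapOrderHom (r₂ c)).app _ x ∈ (Λ[c + 2, 0] : Subcomplex _).obj (op ⦋d⦌) := by
  obtain ⟨u, hu, h⟩ := (mem_K_iff x).1 hx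
  refine mem_horn_of_exists ⟨u.1 - 2, by lia⟩ (by simp; lia) fun i ↦ ?_
  rw [mapOrderHom_app_apply, r₂_val]
  have := h i
  simp only
  lia

lemma ρ_mem_K {d : ℕ} {x : (Δ[c + 4] : SSet.{u}) _⦋d⦌} (hx : x ∈ (K c).obj _) :
    (mapOrderHom (ρ c)).app _ x ∈ (K c).obj (op ⦋d⦌) := by
  obtain ⟨u, hu, h⟩ := (mem_K_iff x).1 hx
  refine (mem_K_iff _).2 ⟨u, hu, fun i ↦ ?_⟩
  rw [mapOrderHom_app_apply, ρ_val]
  have := h i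
  split_ifs <;> lia

lemma ρ_mem_D {d : ℕ} (x : (Δ[c + 4] : SSet.{u}) _⦋d⦌) (k l : ℕ) (hk : k ≠ 1) (hl : l ≠ 1)
    (hk : k < 4) (hl : l < 4) :
    (mapOrderHom (ρ c)).app _ x ∈ (D c k l).obj (op ⦋d⦌) := by
  refine (mem_D_iff _ _ _).2 fun i ↦ ?_
  rw [mapOrderHom_app_apply, ρ_val]
  split_ifs <;> lia

lemma r₁_eq_r₂ {d : ℕ} {x : (Δ[c + 4] : SSet.{u}) _⦋d⦌}
    (h₁ : x ∈ (D c 1 1).obj _) (h₂ : x ∈ (D c 0 2).obj _) :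
    (mapOrderHom (r₁ c)).app (op ⦋d⦌) x = (mapOrderHom (r₂ c)).app (op ⦋d⦌) x := by
  ext i : 1
  have h₁ := (mem_D_iff x _ _).1 h₁ i
  have h₂ := (mem_D_iff x _ _).1 h₂ i
  rw [mapOrderHom_app_apply, mapOrderHom_app_apply, Fin.ext_iff, r₁_val, r₂_val]
  lia

/-- This makes the copy along `ρ` compatible with the values on `K` and with the diagram in the
base. -/
lemma r₂_ρ {d : ℕ} {x : (Δ[c + 4] : SSet.{u}) _⦋d⦌} :
    (mapOrderHom (r₂ c)).app (op ⦋d⦌) ((mapOrderHom (ρ c)).app (op ⦋d⦌) x) =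
      (mapOrderHom (r₂ c)).app (op ⦋d⦌) x := by
  ext i : 1
  rw [mapOrderHom_app_apply, mapOrderHom_app_apply, mapOrderHom_app_apply, Fin.ext_iff,
    r₂_val, r₂_val, ρ_val]
  split_ifs <;> lia

lemma ρ_eq_self {d : ℕ} {x : (Δ[c + 4] : SSet.{u}) _⦋d⦌} (h₁ : x ∈ (D c 0 2).obj _)
    (h₂ : x ∈ (D c 3 3).obj _) : (mapOrderHom (ρ c)).app (op ⦋d⦌) x = x := by
  ext i : 1
  have h₁ := (mem_D_iff x _ _).1 h₁ i
  have h₂ := (mem_D_iff x _ _).1 h₂ i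
  rw [mapOrderHom_app_apply, Fin.ext_iff, ρ_val]
  split_ifs <;> lia

lemma r₁_incl {d : ℕ} (x : (Δ[c + 2] : SSet.{u}) _⦋d⦌) :
    (mapOrderHom (r₁ c)).app (op ⦋d⦌) ((mapOrderHom (incl c)).app (op ⦋d⦌) x) = x := by
  ext i : 1
  rw [mapOrderHom_app_apply, mapOrderHom_app_apply, Fin.ext_iff, r₁_val, incl_val]
  split_ifs <;> lia

lemma incl_mem_D {d : ℕ} (x : (Δ[c + 2] : SSet.{u}) _⦋d⦌) (k l : ℕ) (hk : k = 1 ∨ k = 2)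
    (hl : l = 1 ∨ l = 2) :
    (mapOrderHom (incl c)).app (op ⦋d⦌) x ∈ (D c k l).obj _ := by
  refine (mem_D_iff _ _ _).2 fun i ↦ ?_
  rw [mapOrderHom_app_apply, incl_val]
  split_ifs <;> lia

lemma incl_mem_of_mem_horn {d : ℕ} {x : (Δ[c + 2] : SSet.{u}) _⦋d⦌}
    (hx : x ∈ (Λ[c + 2, 0] : Subcomplex _).obj _) :
    (mapOrderHom (incl c)).app (op ⦋d⦌) x ∈ (K c).obj _ ∨
      (mapOrderHom (incl c)).app (op ⦋d⦌) x ∈ (D c 1 3).obj _ := by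
  obtain ⟨j, hj, h⟩ := (mem_horn_iff_notMem_range _ _).1 hx
  have h' : ∀ i, (x i).1 ≠ j.1 := fun i hi ↦ h ⟨i, Fin.ext hi⟩
  have hj' : j.1 ≠ 0 := fun h ↦ hj (Fin.ext h)
  by_cases hj1 : j.1 = 1
  · refine Or.inr ((mem_D_iff _ _ _).2 fun i ↦ ?_)
    rw [mapOrderHom_app_apply, incl_val]
    have := h' i
    split_ifs <;> lia
  · refine Or.inl ((mem_K_iff _).2 ⟨⟨j.1 + 2, by lia⟩, by simp; lia, fun i ↦ ?_⟩)
    rw [mapOrderHom_app_apply, incl_val]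
    have := h' i
    simp only
    split_ifs <;> lia

variable {E B : SSet.{u}}

/-- The data on an edge `a` of `E` which is needed in order to fill outer horns
whose first edge is `a`: a `3`-simplex of `E` whose face `0, 2, 3` is `a` precomposed with
the degeneracy `0, 0, 1`, and whose face `1, 3` is degenerate. -/
structure ZigZag (a : Δ[1] ⟶ E) where
  /-- the underlying `3`-simplex -/
  σ : Δ[3] ⟶ E
  face₁ : ∀ (d : ℕ) (x : (Δ[3] : SSet.{u}) _⦋d⦌), (∀ i, (x i).1 ≠ 1) →
    σ.app (op ⦋d⦌) x = a.app _ ((mapOrderHom q₁).app _ x)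
  face₀₂ : ∀ (d : ℕ) (x : (Δ[3] : SSet.{u}) _⦋d⦌), (∀ i, (x i).1 ≠ 0 ∧ (x i).1 ≠ 2) →
    σ.app (op ⦋d⦌) x = a.app _ ((mapOrderHom q₂).app _ x)

/-- The image of a zig-zag by a morphism of simplicial sets. -/
def ZigZag.map {a : Δ[1] ⟶ E} (z : ZigZag a) (φ : E ⟶ B) : ZigZag (a ≫ φ) where
  σ := z.σ ≫ φ
  face₁ d x hx := congrArg (φ.app _) (z.face₁ d x hx)
  face₀₂ d x hx := congrArg (φ.app _) (z.face₀₂ d x hx)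

lemma hornEdge01_app_val (n : ℕ) (hn : 2 ≤ n) {d : ℕ} (y : (Δ[1] : SSet.{u}) _⦋d⦌)
    (i : Fin (d + 1)) :
    (DFunLike.coe (F := (Δ[n] : SSet.{u}) _⦋d⦌)
      ((InftyCat.hornEdge01 n hn).app (op ⦋d⦌) y).1 i).1 = (y i).1 := by
  change ((![0, 1] : Fin 2 → Fin (n + 1)) (y i)).1 = _
  generalize y i = t
  fin_cases t
  · rfl
  · simp [Nat.mod_eq_of_lt (show 1 < n + 1 by lia)]

variable (f : (Λ[c + 2, 0] : SSet.{u}) ⟶ E)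

lemma hornEdge01_comp_app {d : ℕ} (y : (Δ[1] : SSet.{u}) _⦋d⦌) (z : (Δ[c + 2] : SSet.{u}) _⦋d⦌)
    (hz : z ∈ (Λ[c + 2, 0] : Subcomplex _).obj _) (h : ∀ i, (z i).1 = (y i).1) :
    (InftyCat.hornEdge01 (c + 2) (by lia) ≫ f).app (op ⦋d⦌) y = f.app _ ⟨z, hz⟩ := by
  refine congrArg (f.app (op ⦋d⦌)) (Subtype.ext ?_)
  ext i : 1
  exact Fin.ext ((hornEdge01_app_val _ _ y i).trans (h i).symm)

variable {f}

/-- The extension to the simplices that miss a vertex of the tail. -/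
lemma exists_extension_K [Quasicategory E]
    (z : ZigZag (InftyCat.hornEdge01 (c + 2) (by lia) ≫ f)) :
    ∃ F : (K c : SSet.{u}) ⟶ E,
      (∀ (d : ℕ) (x : (Δ[c + 4] : SSet.{u}) _⦋d⦌) (hx : x ∈ (K c).obj _),
        x ∈ (D c 1 1).obj _ → F.app (op ⦋d⦌) ⟨x, hx⟩ =
          f.app _ ⟨(mapOrderHom (r₁ c)).app _ x, r₁_mem_of_mem_K hx⟩) ∧
      ∀ (d : ℕ) (x : (Δ[c + 4] : SSet.{u}) _⦋d⦌) (hx : x ∈ (K c).obj _),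
        x ∈ (D c 0 2).obj _ → F.app (op ⦋d⦌) ⟨x, hx⟩ =
          f.app _ ⟨(mapOrderHom (r₂ c)).app _ x, r₂_mem_of_mem_K hx⟩ := by
  obtain ⟨k, hk₁, hk₂⟩ := Subcomplex.exists_glue_apply
    (Subcomplex.mapsTo (K c ⊓ D c 1 1) Λ[c + 2, 0] (mapOrderHom (r₁ c))
      (fun _ _ hx ↦ r₁_mem_of_mem_K hx.1) ≫ f)
    (Subcomplex.mapsTo (K c ⊓ D c 0 2) Λ[c + 2, 0] (mapOrderHom (r₂ c))
      (fun _ _ hx ↦ r₂_mem_of_mem_K hx.1) ≫ f) (fun d x h₁ h₂ ↦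
        congrArg (f.app (op ⦋d⦌)) (Subtype.ext (r₁_eq_r₂ h₁.2 h₂.2)))
  -- The two conditions on the zig-zag are exactly the compatibilities on `{0, 2, 3}` and `{1, 3}`.
  obtain ⟨k', hk₁', hk₂'⟩ := Subcomplex.exists_glue_apply k
    ((T c).ι ≫ mapOrderHom (r₃ c) ≫ z.σ) (by
      rintro d x (hx | hx) hT
      · refine (hk₁ d x hx).trans (Eq.trans ?_ (z.face₁ d ((mapOrderHom (r₃ c)).app _ x) ?_).symm)
        · refine (hornEdge01_comp_app f _ ((mapOrderHom (r₁ c)).app _ x)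
            (r₁_mem_of_mem_K hx.1) fun i ↦ ?_).symm
          rw [mapOrderHom_app_apply, mapOrderHom_app_apply, mapOrderHom_app_apply]
          have := (mem_T_iff x).1 hT i
          rw [r₁_val, q₁_val, r₃_val]
          lia
        · intro i
          have := (mem_D_iff x _ _).1 hx.2 i
          rw [mapOrderHom_app_apply, r₃_val]
          lia
      · refine (hk₂ d x hx).trans (Eq.trans ?_ (z.face₀₂ d ((mapOrderHom (r₃ c)).app _ x) ?_).symm)
        · refine (hornEdge01_comp_app f _ ((mapOrderHom (r₂ c)).app _ x)
            (r₂_mem_of_mem_K hx.1) fun i ↦ ?_).symm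
          rw [mapOrderHom_app_apply, mapOrderHom_app_apply, mapOrderHom_app_apply]
          have := (mem_T_iff x).1 hT i
          rw [r₂_val, q₂_val]
          lia
        · intro i
          have := (mem_D_iff x _ _).1 hx.2 i
          rw [mapOrderHom_app_apply, r₃_val]
          lia)
  obtain ⟨F, hF⟩ := Subcomplex.exists_extension_apply innerAnodyneExtensions_sup_T_le_K k'
  exact ⟨F, fun d x hx hx' ↦ (hF d x (Or.inl (Or.inl ⟨hx, hx'⟩))).trans
      ((hk₁' d x (Or.inl ⟨hx, hx'⟩)).trans (hk₁ d x ⟨hx, hx'⟩)),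
    fun d x hx hx' ↦ (hF d x (Or.inl (Or.inr ⟨hx, hx'⟩))).trans
      ((hk₁' d x (Or.inr ⟨hx, hx'⟩)).trans (hk₂ d x ⟨hx, hx'⟩))⟩

/-- Outer horns `Λ[n, 0]` with `n ≥ 2` can be filled relatively to an inner fibration `p`
between quasicategories if the first edge is part of a zig-zag. -/
theorem exists_lift [Quasicategory E] [Quasicategory B] (p : E ⟶ B) [InnerFibration p]
    (g : Δ[c + 2] ⟶ B) (w : f ≫ p = Λ[c + 2, 0].ι ≫ g)
    (z : ZigZag (InftyCat.hornEdge01 (c + 2) (by lia) ≫ f)) :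
    ∃ h : Δ[c + 2] ⟶ E, Λ[c + 2, 0].ι ≫ h = f ∧ h ≫ p = g := by
  have w' : ∀ (d : ℕ) (y : (Δ[c + 2] : SSet.{u}) _⦋d⦌)
      (hy : y ∈ (Λ[c + 2, 0] : Subcomplex _).obj _),
      p.app (op ⦋d⦌) (f.app _ ⟨y, hy⟩) = g.app _ y := fun d y hy ↦
    congr($(w).app (op ⦋d⦌) ⟨y, hy⟩)
  obtain ⟨F, hF₁, hF₂⟩ := exists_extension_K z
  -- the extension in the base
  obtain ⟨k, hk₁, hk₂⟩ := Subcomplex.exists_glue_apply (F ≫ p)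
    ((D c 1 1).ι ≫ mapOrderHom (r₁ c) ≫ g) (fun d x hK hx ↦
      (congrArg (p.app (op ⦋d⦌)) (hF₁ d x hK hx)).trans (w' _ _ _))
  obtain ⟨k', hk₁', hk₂'⟩ := Subcomplex.exists_glue_apply k
    ((D c 0 2).ι ≫ mapOrderHom (r₂ c) ≫ g) (by
      rintro d x (hx | hx) hx'
      · exact (hk₁ d x hx).trans
          ((congrArg (p.app (op ⦋d⦌)) (hF₂ d x hx hx')).trans (w' _ _ _))
      · exact (hk₂ d x hx).trans (congrArg (g.app (op ⦋d⦌)) (r₁_eq_r₂ hx hx')))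
  obtain ⟨G', hG'⟩ := Subcomplex.exists_extension_apply innerAnodyneExtensions_K_sup_le_top k'
  obtain ⟨G, hG⟩ : ∃ G : Δ[c + 4] ⟶ B, ∀ (d : ℕ) (x : (Δ[c + 4] : SSet.{u}) _⦋d⦌),
      G.app (op ⦋d⦌) x = G'.app (op ⦋d⦌) ⟨x, by trivial⟩ :=
    ⟨(Subcomplex.topIso _).inv ≫ G', fun _ _ ↦ rfl⟩
  have hGK : ∀ (d : ℕ) (x : (Δ[c + 4] : SSet.{u}) _⦋d⦌) (hx : x ∈ (K c).obj _),
      p.app (op ⦋d⦌) (F.app _ ⟨x, hx⟩) = G.app _ x := fun d x hx ↦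
    ((hG d x).trans ((hG' d x (Or.inl (Or.inl hx))).trans
      ((hk₁' d x (Or.inl hx)).trans (hk₁ d x hx)))).symm
  have hG₁ : ∀ (d : ℕ) (x : (Δ[c + 4] : SSet.{u}) _⦋d⦌), x ∈ (D c 1 1).obj _ →
      G.app (op ⦋d⦌) x = g.app _ ((mapOrderHom (r₁ c)).app _ x) := fun d x hx ↦
    (hG d x).trans ((hG' d x (Or.inl (Or.inr hx))).trans
      ((hk₁' d x (Or.inr hx)).trans (hk₂ d x hx)))
  have hG₂ : ∀ (d : ℕ) (x : (Δ[c + 4] : SSet.{u}) _⦋d⦌), x ∈ (D c 0 2).obj _ →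
      G.app (op ⦋d⦌) x = g.app _ ((mapOrderHom (r₂ c)).app _ x) := fun d x hx ↦
    (hG d x).trans ((hG' d x (Or.inr hx)).trans (hk₂' d x hx))
  have hD : ∀ (d : ℕ) (x : (Δ[c + 4] : SSet.{u}) _⦋d⦌), x ∈ (D c 1 3).obj _ →
      x ∈ (D c 1 1).obj _ := fun d x hx ↦ (mem_D_iff _ _ _).2 fun i ↦ by
    have := (mem_D_iff _ _ _).1 hx i
    lia
  -- the simplices which miss the vertex `3`
  obtain ⟨l, hl₁, hl₂⟩ := Subcomplex.exists_glue_apply F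
    (Subcomplex.mapsTo (D c 1 3) Λ[c + 2, 0] (mapOrderHom (r₁ c))
      (fun _ _ hx ↦ r₁_mem_of_mem_D hx) ≫ f) (fun d x h₁ h₂ ↦ hF₁ d x h₁ (hD d x h₂))
  -- The value of `F'` on `{1} ∪ tail` will be the face absent from the horn.
  obtain ⟨F', hF', hpF'⟩ := Subcomplex.exists_lift_apply innerAnodyneExtensions_K_sup_D_le p l G (by
    rintro d x (hx | hx)
    · exact (congrArg (p.app (op ⦋d⦌)) (hl₁ d x hx)).trans (hGK d x hx)
    · exact (congrArg (p.app (op ⦋d⦌)) (hl₂ d x hx)).trans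
        ((w' _ _ _).trans (hG₁ d x (hD d x hx)).symm))
  -- the simplices which miss the vertex `2`
  have hρ : ∀ (d : ℕ) (x : (Δ[c + 4] : SSet.{u}) _⦋d⦌),
      (mapOrderHom (ρ c)).app (op ⦋d⦌) x ∈ (K c ⊔ D c 3 3).obj _ := fun d x ↦
    Or.inr (ρ_mem_D x 3 3 (by lia) (by lia) (by lia) (by lia))
  -- Through `ρ`, the face on `{3} ∪ tail` is made equal to the one just built on `{1} ∪ tail`.
  obtain ⟨l', hl₁', hl₂'⟩ := Subcomplex.exists_glue_apply F'
    (Subcomplex.mapsTo (D c 0 2) (K c ⊔ D c 3 3) (mapOrderHom (ρ c))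
      (fun d x _ ↦ hρ d x) ≫ F') (by
    rintro d x (hx | hx) hx'
    · refine Eq.trans (((hF' d x (Or.inl hx)).trans (hl₁ d x hx)).trans (hF₂ d x hx hx')) ?_
      refine Eq.trans ?_ (((hF' d _ (Or.inl (ρ_mem_K hx))).trans
        (hl₁ d _ (ρ_mem_K hx))).trans (hF₂ d _ (ρ_mem_K hx)
          (ρ_mem_D x 0 2 (by lia) (by lia) (by lia) (by lia)))).symm
      exact congrArg (f.app (op ⦋d⦌)) (Subtype.ext r₂_ρ.symm)
    · exact congrArg (F'.app (op ⦋d⦌)) (Subtype.ext (ρ_eq_self hx' hx).symm))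
  obtain ⟨F'', hF'', hpF''⟩ := Subcomplex.exists_lift_apply innerAnodyneExtensions_K_sup_face_sup_D_le p l' G (by
    rintro d x (hx | hx)
    · exact (congrArg (p.app (op ⦋d⦌)) (hl₁' d x hx)).trans (hpF' d x hx)
    · refine (congrArg (p.app (op ⦋d⦌)) (hl₂' d x hx)).trans ((hpF' d _ (hρ d x)).trans ?_)
      rw [hG₂ d x hx, hG₂ d _ (ρ_mem_D x 0 2 (by lia) (by lia) (by lia) (by lia)), r₂_ρ])
  have hincl : ∀ (d : ℕ) (x : (Δ[c + 2] : SSet.{u}) _⦋d⦌),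
      (mapOrderHom (incl c)).app (op ⦋d⦌) x ∈ (K c ⊔ D c 3 3 ⊔ D c 2 2).obj _ := fun d x ↦
    Or.inr (incl_mem_D x 2 2 (by lia) (by lia))
  have hincl₁ : ∀ (d : ℕ) (x : (Δ[c + 2] : SSet.{u}) _⦋d⦌),
      (mapOrderHom (incl c)).app (op ⦋d⦌) x ∈ (D c 1 1).obj _ := fun d x ↦
    incl_mem_D x 1 1 (by lia) (by lia)
  -- The filler is the face on `{0, 3} ∪ tail`. The horn's face opposite `1` lands in `D c 1 3`, its
  -- other faces in `K c`; both carry `f` composed with `r₁`.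
  obtain ⟨h, hh⟩ : ∃ h : Δ[c + 2] ⟶ E, ∀ (d : ℕ) (x : (Δ[c + 2] : SSet.{u}) _⦋d⦌),
      h.app (op ⦋d⦌) x = F''.app _ ⟨(mapOrderHom (incl c)).app _ x, hincl d x⟩ :=
    ⟨(Subcomplex.topIso _).inv ≫
      Subcomplex.mapsTo ⊤ _ (mapOrderHom (incl c)) (fun d x _ ↦ hincl d x) ≫ F'',
      fun _ _ ↦ rfl⟩
  refine ⟨h, ?_, ?_⟩
  · ext ⟨⟨d⟩⟩ ⟨x, hx⟩
    refine (hh d x).trans ?_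
    have e : (⟨(mapOrderHom (r₁ c)).app (op ⦋d⦌) ((mapOrderHom (incl c)).app _ x),
        by rw [r₁_incl]; exact hx⟩ : (Λ[c + 2, 0] : Subcomplex.{u} _).obj (op ⦋d⦌)) = ⟨x, hx⟩ :=
      Subtype.ext (r₁_incl x)
    refine Eq.trans ?_ (congrArg (f.app (op ⦋d⦌)) e)
    obtain hx' | hx' := incl_mem_of_mem_horn hx
    · exact (hF'' d _ (Or.inl (Or.inl hx'))).trans ((hl₁' d _ (Or.inl hx')).trans
        ((hF' d _ (Or.inl hx')).trans ((hl₁ d _ hx').trans (hF₁ d _ hx' (hincl₁ d x)))))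
    · have hx'' : (mapOrderHom (incl c)).app (op ⦋d⦌) x ∈ (K c ⊔ D c 3 3).obj _ :=
        K_sup_D_le _ (Or.inr hx')
      exact (hF'' d _ (Or.inl hx'')).trans ((hl₁' d _ hx'').trans
        ((hF' d _ (Or.inr hx')).trans (hl₂ d _ hx')))
  · ext ⟨⟨d⟩⟩ x
    refine (congrArg (p.app (op ⦋d⦌)) (hh d x)).trans ((hpF'' d _ (hincl d x)).trans
      ((hG₁ d _ (hincl₁ d x)).trans (congrArg (g.app (op ⦋d⦌)) (r₁_incl x))))

end specialOuterHorn

end stdSimplex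

end SSet

/-! ### Homotopy inverses in a quasicategory -/

namespace SSet

open Opposite

section

variable {X : SSet.{u}} [Quasicategory X]

namespace Quasicategory

lemma exists_filling₂₁ (f₀ f₂ : X _⦋1⦌) (h : X.δ 0 f₂ = X.δ 1 f₀) :
    ∃ s : X _⦋2⦌, X.δ 0 s = f₀ ∧ X.δ 2 s = f₂ := by
  obtain ⟨φ, h₂, h₀⟩ := horn₂₁.isPushout.exists_desc (yonedaEquiv.symm f₂) (yonedaEquiv.symm f₀)
    (by simp only [stdSimplex.δ_comp_yonedaEquiv_symm, h])
  obtain ⟨s, rfl⟩ := hornFilling (by simp) (by simp [Fin.lt_def]) φ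
  rw [← Category.assoc, horn.ι_ι] at h₀ h₂
  refine ⟨yonedaEquiv s, ?_, ?_⟩ <;> rw [← stdSimplex.yonedaEquiv_δ_comp] <;> simp [*]

lemma exists_filling₃₁ (f₀ f₂ f₃ : X _⦋2⦌) (h₁₂ : X.δ 2 f₀ = X.δ 0 f₃)
    (h₁₃ : X.δ 1 f₀ = X.δ 0 f₂) (h₂₃ : X.δ 2 f₂ = X.δ 2 f₃) :
    ∃ s : X _⦋3⦌, X.δ 0 s = f₀ ∧ X.δ 2 s = f₂ ∧ X.δ 3 s = f₃ := by
  obtain ⟨φ, h₀, h₂, h₃⟩ := horn₃₁.exists_desc (yonedaEquiv.symm f₀) (yonedaEquiv.symm f₂)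
    (yonedaEquiv.symm f₃) (by simp only [stdSimplex.δ_comp_yonedaEquiv_symm, h₁₂])
    (by simp only [stdSimplex.δ_comp_yonedaEquiv_symm, h₁₃])
    (by simp only [stdSimplex.δ_comp_yonedaEquiv_symm, h₂₃])
  obtain ⟨s, rfl⟩ := hornFilling (by simp) (by simp [Fin.lt_def]) φ
  rw [← Category.assoc, horn.ι_ι] at h₀ h₂ h₃
  refine ⟨yonedaEquiv s, ?_, ?_, ?_⟩ <;> rw [← stdSimplex.yonedaEquiv_δ_comp] <;> simp [*]

lemma exists_filling₃₂ (f₀ f₁ f₃ : X _⦋2⦌) (h₀₂ : X.δ 2 f₁ = X.δ 1 f₃)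
    (h₁₂ : X.δ 2 f₀ = X.δ 0 f₃) (h₂₃ : X.δ 0 f₀ = X.δ 0 f₁) :
    ∃ s : X _⦋3⦌, X.δ 0 s = f₀ ∧ X.δ 1 s = f₁ ∧ X.δ 3 s = f₃ := by
  obtain ⟨φ, h₀, h₂, h₃⟩ := horn₃₂.exists_desc (yonedaEquiv.symm f₀) (yonedaEquiv.symm f₁)
    (yonedaEquiv.symm f₃) (by simp only [stdSimplex.δ_comp_yonedaEquiv_symm, h₀₂])
    (by simp only [stdSimplex.δ_comp_yonedaEquiv_symm, h₁₂])
    (by simp only [stdSimplex.δ_comp_yonedaEquiv_symm, h₂₃])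
  obtain ⟨s, rfl⟩ := hornFilling (by simp) (by simp [Fin.lt_def]) φ
  rw [← Category.assoc, horn.ι_ι] at h₀ h₂ h₃
  refine ⟨yonedaEquiv s, ?_, ?_, ?_⟩ <;> rw [← stdSimplex.yonedaEquiv_δ_comp] <;> simp [*]

end Quasicategory

lemma δ_δ_eq (Y : SSet.{u}) {n : ℕ} (s : Y _⦋n + 2⦌) (i k : Fin (n + 2)) (j l : Fin (n + 3))
    (h : SimplexCategory.δ i ≫ SimplexCategory.δ j = SimplexCategory.δ k ≫ SimplexCategory.δ l) :
    Y.δ i (Y.δ j s) = Y.δ k (Y.δ l s) := by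
  simp only [SimplicialObject.δ, ← Functor.map_comp_apply, ← op_comp, h]

/-- The `2`-truncation of a quasicategory is a `2`-truncated quasicategory. -/
instance : Truncated.Quasicategory₂ ((truncation 2).obj X) where
  fill21 {x₀ x₁ x₂} e₀₁ e₁₂ := by
    obtain ⟨s, h₀, h₂⟩ := Quasicategory.exists_filling₂₁ (X := X) e₁₂.edge e₀₁.edge
      (e₀₁.tgt_eq.trans e₁₂.src_eq.symm)
    refine ⟨⟨⟨X.δ 1 s, ?_, ?_⟩, ⟨s, h₂, h₀, rfl⟩⟩⟩
    · refine Eq.trans (δ_δ_eq X s 1 1 1 2 (by decide)) ?_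
      rw [h₂]
      exact e₀₁.src_eq
    · refine Eq.trans (δ_δ_eq X s 0 0 1 0 (by decide)) ?_
      rw [h₀]
      exact e₁₂.tgt_eq
  fill31 {x₀ x₁ x₂ x₃ e₀₁ e₁₂ e₂₃ e₀₂ e₁₃ e₀₃} f₃ f₀ f₂ := by
    obtain ⟨s, h₀, h₂, h₃⟩ := Quasicategory.exists_filling₃₁ (X := X)
      f₀.simplex f₂.simplex f₃.simplex (f₀.d₂.trans f₃.d₀.symm) (f₀.d₁.trans f₂.d₀.symm)
      (f₂.d₂.trans f₃.d₂.symm)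
    refine ⟨⟨X.δ 1 s, ?_, ?_, ?_⟩⟩
    · refine Eq.trans (δ_δ_eq X s 2 1 1 3 (by decide)) ?_
      rw [h₃]
      exact f₃.d₁
    · refine Eq.trans (δ_δ_eq X s 0 0 1 0 (by decide)) ?_
      rw [h₀]
      exact f₀.d₀
    · refine Eq.trans (δ_δ_eq X s 1 1 1 2 (by decide)) ?_
      rw [h₂]
      exact f₂.d₁
  fill32 {x₀ x₁ x₂ x₃ e₀₁ e₁₂ e₂₃ e₀₂ e₁₃ e₀₃} f₃ f₀ f₁ := by
    obtain ⟨s, h₀, h₁, h₃⟩ := Quasicategory.exists_filling₃₂ (X := X)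
      f₀.simplex f₁.simplex f₃.simplex (f₁.d₂.trans f₃.d₁.symm) (f₀.d₂.trans f₃.d₀.symm)
      (f₀.d₀.trans f₁.d₀.symm)
    refine ⟨⟨X.δ 2 s, ?_, ?_, ?_⟩⟩
    · refine Eq.trans (δ_δ_eq X s 2 2 2 3 (by decide)) ?_
      rw [h₃]
      exact f₃.d₂
    · refine Eq.trans (δ_δ_eq X s 0 1 2 0 (by decide)) ?_
      rw [h₀]
      exact f₀.d₁
    · refine Eq.trans (δ_δ_eq X s 1 1 2 1 (by decide)) ?_
      rw [h₁]
      exact f₁.d₁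

end

namespace Truncated

open SimplicialObject.Truncated

variable {A : Truncated.{u} 2} [Quasicategory₂ A] {x y : A _⦋0⦌₂}

variable (A) in
/-- The comparison functor from the homotopy category of a `2`-truncated quasicategory
to the category of homotopy classes of edges. -/
noncomputable def toHomotopyCategory₂ : A.HomotopyCategory ⥤ HomotopyCategory₂ A :=
  HomotopyCategory.lift HomotopyCategory₂.mk HomotopyCategory₂.homMk
    (fun x ↦ HomotopyCategory₂.homMk_id ⟨x⟩) (fun s ↦ s.homotopyCategory₂_fac)

/-- An edge of a `2`-truncated quasicategory whose class in the homotopy category is an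
isomorphism has an inverse. -/
lemma Edge.exists_inverse (e : Edge x y) (he : IsIso (HomotopyCategory.homMk e)) :
    ∃ e' : Edge y x, Nonempty (CompStruct e e' (.id x)) ∧ Nonempty (CompStruct e' e (.id y)) := by
  have h : (toHomotopyCategory₂ A).map (HomotopyCategory.homMk e) = HomotopyCategory₂.homMk e :=
    HomotopyCategory.lift_map_homMk _ _ _ _ _
  -- In `HomotopyCategory₂` each morphism is the class of one edge, and relations between composites
  -- are witnessed by `2`-simplices, so an inverse can be read off.
  have : IsIso (HomotopyCategory₂.homMk e) := by
    rw [← h]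
    exact Functor.map_isIso (toHomotopyCategory₂ A) (HomotopyCategory.homMk e)
  obtain ⟨e', he'⟩ := HomotopyCategory₂.homMk_surjective (inv (HomotopyCategory₂.homMk e))
  refine ⟨e', CompStruct.nonempty_iff.2 ?_, CompStruct.nonempty_iff.2 ?_⟩
  · rw [he', IsIso.hom_inv_id]; rfl
  · rw [he', IsIso.inv_hom_id]; rfl

end Truncated

end SSet

lemma InftyCat.IsEquivalence.exists_inverse {C : SSet.{u}} [SSet.Quasicategory C] {x y : C _⦋0⦌}
    {α : SSet.Edge x y} (hα : InftyCat.IsEquivalence α) :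
    ∃ β : SSet.Edge y x, Nonempty (SSet.Edge.CompStruct α β (.id x)) ∧
      Nonempty (SSet.Edge.CompStruct β α (.id y)) :=
  SSet.Truncated.Edge.exists_inverse α.toTruncated hα

/-! ### The zig-zag of an invertible edge -/

namespace SSet

open Opposite

namespace stdSimplex

namespace specialOuterHorn

/-- The map `⦋3⦌ ⟶ ⦋2⦌` which sends `0, 1, 2, 3` to `0, 0, 1, 2`. -/
def q₃ : Fin 4 →o Fin 3 where
  toFun i := ⟨i.1 - 1, by lia⟩
  monotone' i j h := by simp only [Fin.le_def] at h ⊢; lia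

lemma δ_one_q₃ {d : ℕ} (x : (Δ[3] : SSet.{u}) _⦋d⦌) (hx : ∀ i, (x i).1 ≠ 1) :
    (stdSimplex.δ (n := 2) 1).app (op ⦋d⦌) ((mapOrderHom q₃).app _ x) = x := by
  ext i : 1
  change Fin.succAbove 1 (q₃ (x i)) = x i
  have := hx i
  revert this
  generalize x i = t
  revert t
  decide

lemma σ_zero_q₃ {d : ℕ} (x : (Δ[3] : SSet.{u}) _⦋d⦌) :
    (stdSimplex.σ (n := 1) 0).app (op ⦋d⦌) ((mapOrderHom q₃).app _ x) =
      (mapOrderHom q₁).app _ x := by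
  ext i : 1
  change Fin.predAbove 0 (q₃ (x i)) = q₁ (x i)
  generalize x i = t
  revert t
  decide

lemma δ_zero_δ_one_q₁ {d : ℕ} (x : (Δ[3] : SSet.{u}) _⦋d⦌)
    (hx : ∀ i, (x i).1 ≠ 0 ∧ (x i).1 ≠ 2) :
    (stdSimplex.δ (n := 1) 1 ≫ stdSimplex.δ (n := 2) 0).app (op ⦋d⦌)
      ((mapOrderHom q₁).app _ x) = x := by
  ext i : 1
  change Fin.succAbove 0 (Fin.succAbove 1 (q₁ (x i))) = x i
  have := hx i
  revert this
  generalize x i = t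
  revert t
  decide

lemma σ_zero_δ_zero_q₁ {d : ℕ} (x : (Δ[3] : SSet.{u}) _⦋d⦌) :
    (stdSimplex.σ (n := 0) 0 ≫ stdSimplex.δ (n := 0) 0).app (op ⦋d⦌)
      ((mapOrderHom q₁).app _ x) = (mapOrderHom q₂).app _ x := by
  ext i : 1
  change Fin.succAbove 0 (Fin.predAbove 0 (q₁ (x i))) = q₂ (x i)
  generalize x i = t
  revert t
  decide

variable {C : SSet.{u}} [Quasicategory C] {x y : C _⦋0⦌} {α : Edge x y} {β : Edge y x}

/-- An edge of a quasicategory which has a homotopy inverse is part of a zig-zag. -/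
lemma nonempty_zigZag (s₃ : Edge.CompStruct α β (.id x)) (s₀ : Edge.CompStruct β α (.id y)) :
    Nonempty (ZigZag (yonedaEquiv.symm α.edge)) := by
  -- The vertices are `x, y, x, y`; the faces opposite `0`, `1`, `3` are prescribed, and the one
  -- opposite `2` is left free.
  obtain ⟨s, h₀, h₁, -⟩ := Quasicategory.exists_filling₃₂ s₀.simplex (C.σ 0 α.edge) s₃.simplex
    ((Edge.CompStruct.idComp α).d₂.trans s₃.d₁.symm) (s₀.d₂.trans s₃.d₀.symm)
    (s₀.d₀.trans (Edge.CompStruct.idComp α).d₀.symm)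
  refine ⟨⟨yonedaEquiv.symm s, fun d x hx ↦ ?_, fun d x hx ↦ ?_⟩⟩
  · have e : stdSimplex.δ 1 ≫ yonedaEquiv.symm s = stdSimplex.σ 0 ≫ yonedaEquiv.symm α.edge := by
      rw [stdSimplex.δ_comp_yonedaEquiv_symm, stdSimplex.σ_comp_yonedaEquiv_symm, h₁]
    have := congr($(e).app (op ⦋d⦌) ((mapOrderHom q₃).app _ x))
    exact (congrArg ((yonedaEquiv.symm s).app (op ⦋d⦌)) (δ_one_q₃ x hx)).symm.trans
      (this.trans (congrArg ((yonedaEquiv.symm α.edge).app (op ⦋d⦌)) (σ_zero_q₃ x)))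
  · have e : (stdSimplex.δ 1 ≫ stdSimplex.δ 0) ≫ yonedaEquiv.symm s =
        (stdSimplex.σ 0 ≫ stdSimplex.δ 0) ≫ yonedaEquiv.symm α.edge := by
      rw [Category.assoc, Category.assoc, stdSimplex.δ_comp_yonedaEquiv_symm,
        stdSimplex.δ_comp_yonedaEquiv_symm, stdSimplex.δ_comp_yonedaEquiv_symm,
        stdSimplex.σ_comp_yonedaEquiv_symm, h₀, s₀.d₁, Edge.id_edge, Edge.tgt_eq]
    have := congr($(e).app (op ⦋d⦌) ((mapOrderHom q₁).app _ x))
    exact (congrArg ((yonedaEquiv.symm s).app (op ⦋d⦌)) (δ_zero_δ_one_q₁ x hx)).symm.trans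
      (this.trans (congrArg ((yonedaEquiv.symm α.edge).app (op ⦋d⦌)) (σ_zero_δ_zero_q₁ x)))

end specialOuterHorn

end stdSimplex

end SSet

/-! ### Reduction of contractibility to horn lifting -/

namespace SSet

open Limits CartesianMonoidalCategory

open scoped modelCategoryQuillen in
/-- A simplicial set `X` such that all maps `∂Δ[m] ⟶ X` extend to `Δ[m]` is a Kan complex. -/
lemma KanComplex.of_exists_extension {X : SSet.{u}}
    (hX : ∀ (m : ℕ) (β : (∂Δ[m] : SSet.{u}) ⟶ X), ∃ γ : (Δ[m] : SSet.{u}) ⟶ X, ∂Δ[m].ι ≫ γ = β) :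
    KanComplex X := by
  have h : modelCategoryQuillen.I.rlp (terminal.from X) := by
    rintro _ _ _ ⟨m⟩
    refine ⟨fun {β _} _ ↦ ?_⟩
    obtain ⟨γ, hγ⟩ := hX m β
    exact ⟨⟨γ, hγ, Subsingleton.elim _ _⟩⟩
  -- Lifting against boundary inclusions gives lifting against all monomorphisms, horn inclusions
  -- among them.
  rw [← rlp_monomorphisms] at h
  rw [KanComplex, HomotopicalAlgebra.isFibrant_iff, modelCategoryQuillen.fibration_iff]
  exact MorphismProperty.antitone_rlp modelCategoryQuillen.J_le_monomorphisms _ h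

/-- The map `C ⟶ C ^ L` which sends a simplex to the corresponding constant map. -/
noncomputable def constMap (L C : SSet.{u}) : C ⟶ (ihom L).obj C := MonoidalClosed.curry (snd L C)

lemma constMap_pre {K L : SSet.{u}} (j : K ⟶ L) (C : SSet.{u}) :
    constMap L C ≫ (MonoidalClosed.pre j).app C = constMap K C := by
  rw [constMap, MonoidalClosed.curry_pre_app, whiskerRight_snd, constMap]

lemma comp_constMap {B C : SSet.{u}} (L : SSet.{u}) (f : B ⟶ C) :
    f ≫ constMap L C = MonoidalClosed.curry (snd L B ≫ f) := by
  rw [constMap, ← MonoidalClosed.curry_natural_left, whiskerLeft_snd]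

lemma toUnit_comp_curry' {A C : SSet.{u}} (K : SSet.{u}) (f : A ⟶ C) :
    toUnit K ≫ MonoidalClosed.curry' f = MonoidalClosed.curry (fst A K ≫ f) := by
  rw [MonoidalClosed.curry', ← MonoidalClosed.curry_natural_left, rightUnitor_hom,
    whiskerLeft_fst_assoc]

/-- Extending a map `K ⟶ C ^ B ×_{C ^ A} {f}` along `j : K ⟶ L` amounts to solving
a lifting problem for `A ⟶ B` relatively to `C ^ L ⟶ C ^ K`. -/
lemma exists_extension_extensionFiber {A B C K L : SSet.{u}} (i : A ⟶ B) (f : A ⟶ C) (j : K ⟶ L)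
    (H : ∀ g : B ⟶ (ihom K).obj C,
      (f ≫ constMap L C) ≫ (MonoidalClosed.pre j).app C = i ≫ g →
        ∃ h : B ⟶ (ihom L).obj C, i ≫ h = f ≫ constMap L C ∧
          h ≫ (MonoidalClosed.pre j).app C = g)
    (b : K ⟶ InftyCat.extensionFiber i f) :
    ∃ c : L ⟶ InftyCat.extensionFiber i f, j ≫ c = b := by
  unfold InftyCat.extensionFiber at b ⊢
  obtain ⟨b', hb'⟩ : ∃ b' : B ⊗ K ⟶ C,
      b ≫ pullback.fst _ _ = MonoidalClosed.curry b' :=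
    ⟨_, (MonoidalClosed.curry_uncurry _).symm⟩
  have hb : i ▷ K ≫ b' = fst A K ≫ f := by
    apply MonoidalClosed.curry_injective
    rw [← MonoidalClosed.curry_pre_app, ← hb', ← toUnit_comp_curry', Category.assoc,
      pullback.condition, ← Category.assoc]
    congr 1
  obtain ⟨h, h₁, h₂⟩ := H (MonoidalClosed.curry ((β_ K B).hom ≫ b')) (by
    rw [Category.assoc, constMap_pre, comp_constMap, ← MonoidalClosed.curry_natural_left]
    congr 1
    rw [BraidedCategory.braiding_naturality_right_assoc, hb, braiding_hom_fst_assoc])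
  obtain ⟨h, rfl⟩ : ∃ h' : L ⊗ B ⟶ C, MonoidalClosed.curry h' = h :=
    ⟨_, MonoidalClosed.curry_uncurry _⟩
  rw [MonoidalClosed.curry_pre_app] at h₂
  rw [comp_constMap, ← MonoidalClosed.curry_natural_left] at h₁
  have h₁ := MonoidalClosed.curry_injective h₁
  have h₂ := MonoidalClosed.curry_injective h₂
  refine ⟨pullback.lift (MonoidalClosed.curry ((β_ B L).hom ≫ h)) (toUnit L) ?_, ?_⟩
  · rw [MonoidalClosed.curry_pre_app, toUnit_comp_curry',
      BraidedCategory.braiding_naturality_left_assoc, h₁, braiding_hom_snd_assoc]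
  · apply pullback.hom_ext
    · rw [Category.assoc, pullback.lift_fst, hb', ← MonoidalClosed.curry_natural_left,
        BraidedCategory.braiding_naturality_right_assoc, h₂, SymmetricCategory.symmetry_assoc]
    · exact toUnit_unique _ _

end SSet

open SSet stdSimplex.specialOuterHorn in
theorem mainTheorem5 (C : SSet.{u}) [SSet.Quasicategory C] {x y : C _⦋0⦌} (α : SSet.Edge x y)
    (hα : InftyCat.IsEquivalence α) (n : ℕ) (hn : 2 ≤ n) (a : (Λ[n, 0] : SSet.{u}) ⟶ C)
    (ha : InftyCat.hornEdge01 n hn ≫ a = SSet.yonedaEquiv.symm α.edge) :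
    InftyCat.IsContractibleInftyGroupoid (InftyCat.extensionFiber Λ[n, 0].ι a) := by
  have h : ∀ (m : ℕ) (β : (∂Δ[m] : SSet.{u}) ⟶ InftyCat.extensionFiber Λ[n, 0].ι a),
      ∃ γ : (Δ[m] : SSet.{u}) ⟶ _, ∂Δ[m].ι ≫ γ = β := by
    obtain ⟨β, ⟨s₃⟩, ⟨s₀⟩⟩ := hα.exists_inverse
    obtain ⟨z⟩ := nonempty_zigZag s₃ s₀
    rw [← ha] at z
    obtain ⟨c, rfl⟩ := Nat.exists_eq_add_of_le' hn
    -- The zig-zag of `α` is pushed along `constMap`, so invertibility of edges in `C ^ Δ[m]` never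
    -- has to be tested pointwise.
    exact fun m ↦ exists_extension_extensionFiber _ _ _
      fun g w ↦ exists_lift _ g w (z.map (constMap Δ[m] C))
  exact ⟨KanComplex.of_exists_extension h, h⟩
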